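/- Let $(\Omega,\mathcal F,P)$ be a probability space and let $X_1,X_2,\dots$ be i.i.d. bounded real random variables (elements of $L^\infty(P)$) with standard deviation $\sigma_{X_1}=\sqrt{\mathrm{Var}[X_1]}$; put $S_n=\sum_{i=1}^n X_i$. For a real random variable $X$ let $q_X(t)=\inf\{m\in\mathbb R : P[X\le m]\ge t\}$ be its quantile function, and for $\lambda\in(0,1]$ let $$\mathcal U_\lambda(X)=\frac1\lambda\int_0^\lambda q_X(t)\,dt .$$ For a probability measure $\mu$ on $(0,1]$ let $\mathcal U_\mu(X)=\int_0^1\mathcal U_\lambda(X)\,\mu(d\lambda)$, and for a non-empty set $\mathcal M$ of probability measures on $(0,1]$ let $\mathcal U_{\mathcal M}(X)=\inf_{\mu\in\mathcal M}\mathcal U_\mu(X)$. Let $u:\mathbb R\to\mathbb R$ be strictly increasing and continuously differentiable, with continuously differentiable inverse $u^{-1}:u(\mathbb R)\to\mathbb R$, and let $\mathcal V_{\mathcal M}(X)=u^{-1}\big(\mathcal U_{\mathcal M}(u(X))\big)$. Assume $$\sup_{\mu\in\mathcal M}\int_0^1\log\frac1\lambda\,\mu(d\lambda)<\infty .$$ Let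 $Z$ be a standard normal random variable (on $\Omega$ or on any other probability space), with density $\phi$ and distribution function $\Phi$; at $\lambda=1$ read $\phi(\Phi^{-1}(1))=\phi(\infty)=0$. Then $$\lim_{n\to\infty}\sqrt n\,\big(E[X_1]-\mathcal V_{\mathcal M}(S_n/n)\big)=-\sigma_{X_1}\,\mathcal U_{\mathcal M}(Z)=-\sigma_{X_1}\inf_{\mu\in\mathcal M}\int_0^1\mathcal U_\lambda(Z)\,\mu(d\lambda)=\sigma_{X_1}\sup_{\mu\in\mathcal M}\int_0^1\frac1\lambda\,\phi\big(\Phi^{-1}(\lambda)\big)\,\mu(d\lambda),$$ where all these integrals converge and the infimum and the supremum are finite. In particular, if $\sigma_{X_1}>0$ and $\mathcal M$ contains some $\mu\neq\delta_1$, then the risk premium $E[X_1]-\mathcal V_{\mathcal M}(S_n/n)$ is of exact order $n^{-1/2}$ as $n\to\infty$. -/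

import Mathlib

open MeasureTheory ProbabilityTheory Filter Topology Asymptotics

namespace RiskPool

noncomputable section

/-- The quantile function `q_X(t) = inf {m ∈ ℝ | P[X ≤ m] ≥ t}` of a real random variable.
It is finite for `0 < t < 1`. At the endpoints `t = 0, 1`, where it may be infinite, the real
infimum may take a default value; the quantile function is only used under integrals over `t`,
where these two points do not matter. -/
def quantile {Ω : Type*} [MeasurableSpace Ω] (P : Measure Ω) (X : Ω → ℝ) (t : ℝ) : ℝ :=
  sInf {m : ℝ | t ≤ P.real {ω | X ω ≤ m}}

/-- The building block `U_l(X) = (1 / l) ∫_0^l q_X(t) dt`, for `l ∈ (0, 1]`. -/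
def tailMean {Ω : Type*} [MeasurableSpace Ω] (P : Measure Ω) (X : Ω → ℝ) (l : ℝ) : ℝ :=
  (1 / l) * ∫ t in (0 : ℝ)..l, quantile P X t

/-- The mixture `U_μ(X) = ∫ U_l(X) μ(dl)`, for `μ` a probability measure on `(0, 1]`. -/
def mixture {Ω : Type*} [MeasurableSpace Ω] (P : Measure Ω)
    (μ : ProbabilityMeasure (Set.Ioc (0 : ℝ) 1)) (X : Ω → ℝ) : ℝ :=
  ∫ l, tailMean P X (l : ℝ) ∂(μ : Measure (Set.Ioc (0 : ℝ) 1))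

/-- The law-invariant coherent functional `U_M(X) = inf_{μ ∈ M} U_μ(X)`. -/
def coherent {Ω : Type*} [MeasurableSpace Ω] (P : Measure Ω)
    (M : Set (ProbabilityMeasure (Set.Ioc (0 : ℝ) 1))) (X : Ω → ℝ) : ℝ :=
  ⨅ μ : M, mixture P μ.1 X

/-- The certainty equivalent `V_M(X) = u⁻¹(U_M(u(X)))`. Here `Function.invFun u` is the inverse of
the injective function `u` on the range of `u`. -/
def certaintyEquivalent {Ω : Type*} [MeasurableSpace Ω] (P : Measure Ω) (u : ℝ → ℝ)
    (M : Set (ProbabilityMeasure (Set.Ioc (0 : ℝ) 1))) (X : Ω → ℝ) : ℝ :=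
  Function.invFun u (coherent P M (fun ω => u (X ω)))

/-- The average risk `S_n / n`, with `S_n` the sum of the first `n` risks `X 0, …, X (n - 1)`. -/
def averageRisk {Ω : Type*} (X : ℕ → Ω → ℝ) (n : ℕ) (ω : Ω) : ℝ :=
  (∑ i ∈ Finset.range n, X i ω) / n

/-- The risk premium `E[X_1] - V_M(S_n / n)` of the average risk; the sequence of risks starts
at index `0`. -/
def riskPremium {Ω : Type*} [MeasurableSpace Ω] (P : Measure Ω) (u : ℝ → ℝ)
    (M : Set (ProbabilityMeasure (Set.Ioc (0 : ℝ) 1))) (X : ℕ → Ω → ℝ) (n : ℕ) : ℝ :=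
  (∫ ω, X 0 ω ∂P) - certaintyEquivalent P u M (averageRisk X n)

/-- `φ(Φ⁻¹(l))` for `l ∈ (0, 1]`, with `φ` the density and `Φ` the distribution function of the
standard normal law; for `l = 1` this is `φ(∞) = 0`. -/
def densityAtQuantile (l : ℝ) : ℝ :=
  if l < 1 then gaussianPDFReal 0 1 (Function.invFun (fun x : ℝ => cdf (gaussianReal 0 1) x) l)
  else 0

end

end RiskPool

/-!
The average risk is `S_n / n = a + W_n / √n` with `a = E[X_1]`, where `W_n` is asymptotically normal
with standard deviation `σ`. Quantiles commute with strictly increasing continuous functions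
(`quantile_comp`), so the `t`-quantile of `u(S_n / n)` is `u(a + q_n(t) / √n)`, with `q_n(t)` the
`t`-quantile of `W_n`. The central limit theorem gives `q_n(t) → σ Φ⁻¹(t)` for each `t ∈ (0, 1)`
(`tendsto_quantile`), hence `√n (u(a + q_n(t) / √n) - u(a)) → u'(a) σ Φ⁻¹(t)`.

The limit has to be taken under the mixtures of the means over `(0, l)`, uniformly over `M`, although
the measures in `M` may charge every neighbourhood of `l = 0`. By Hoeffding's lemma all `W_n` are
sub-Gaussian with the same parameter, so that their quantiles are
`O(√(log (1 / t)) + √(log (1 / (1 - t))))`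
uniformly in `n` (`abs_quantile_le_subgaussianEnvelope`). Near `0` this is at most `δ log (1 / t)`,
for every `δ > 0`, and then the mean of the error over `(0, l)` is at most
`δ (1 + log (1 / l)) + C_δ ‖error‖₁` (`abs_runningMean_le`). The first term is small after
integration, uniformly over `M`, by the bound on the logarithmic moments; the second tends to zero by
dominated convergence (`eventually_forall_abs_integral_runningMean_sub_le`).

Uniform convergence passes to the infimum over `M`, and the delta method for `u⁻¹`, whose derivative
at `u(a)` is `1 / u'(a)`, removes the factor `u'(a)`. The last form of the limit comes from
`∫_0^l Φ⁻¹(t) dt = -φ(Φ⁻¹(l))` (`integral_normalQuantile`), because the derivative of `φ(Φ⁻¹(t))` is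
`-Φ⁻¹(t)`. The integrand `φ(Φ⁻¹(l)) / l` is positive for `l < 1`, so the limit is positive as soon as
`σ > 0` and some measure in `M` charges `(0, 1)`.
-/

namespace RiskPool

/-! ### Quantile functions -/

section Quantile

variable {Ω : Type*} [MeasurableSpace Ω] {P : Measure Ω} [IsProbabilityMeasure P] {X : Ω → ℝ}
  {t : ℝ}

lemma measureReal_setOf_le_eq_cdf (hX : AEMeasurable X P) (m : ℝ) :
    P.real {ω | X ω ≤ m} = cdf (P.map X) m := by
  have := Measure.isProbabilityMeasure_map hX
  rw [cdf_eq_real, map_measureReal_apply_of_aemeasurable hX measurableSet_Iic]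
  rfl

/-- The superlevel set defining the quantile is a closed half-line, because the distribution
function is right-continuous. -/
lemma quantile_le_iff (hX : AEMeasurable X P) (ht : t ∈ Set.Ioo (0 : ℝ) 1) {m : ℝ} :
    quantile P X t ≤ m ↔ t ≤ P.real {ω | X ω ≤ m} := by
  have hmeas := Measure.isProbabilityMeasure_map hX
  simp only [quantile, measureReal_setOf_le_eq_cdf hX]
  set F := cdf (P.map X)
  obtain ⟨b, hb⟩ := ((tendsto_order.1 (tendsto_cdf_atBot (P.map X))).2 t ht.1).exists
  obtain ⟨a, ha⟩ := ((tendsto_order.1 (tendsto_cdf_atTop (P.map X))).1 t ht.2).exists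
  have hbdd : BddBelow {m : ℝ | t ≤ F m} :=
    ⟨b, fun x hx => le_of_not_gt fun h => absurd (F.mono h.le) (by
      have : F b < t := hb
      have : t ≤ F x := hx
      linarith)⟩
  have hne : {m : ℝ | t ≤ F m}.Nonempty := ⟨a, ha.le⟩
  refine ⟨fun h => ?_, fun h => csInf_le hbdd h⟩
  have hev : ∀ x ∈ Set.Ioi m, t ≤ F x := by
    intro x hx
    obtain ⟨y, hy, hyx⟩ := exists_lt_of_csInf_lt hne (h.trans_lt hx)
    exact le_trans hy (F.mono hyx.le)
  have hcont : Tendsto F (𝓝[>] m) (𝓝 (F m)) :=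
    (F.right_continuous m).mono_left (nhdsWithin_mono _ Set.Ioi_subset_Ici_self)
  exact ge_of_tendsto hcont (eventually_nhdsWithin_of_forall hev)

lemma lt_quantile_iff (hX : AEMeasurable X P) (ht : t ∈ Set.Ioo (0 : ℝ) 1) {m : ℝ} :
    m < quantile P X t ↔ P.real {ω | X ω ≤ m} < t := by
  rw [← not_le, quantile_le_iff hX ht, not_le]

lemma monotoneOn_quantile (hX : AEMeasurable X P) :
    MonotoneOn (quantile P X) (Set.Ioo 0 1) := fun _ hs _ ht hst =>
  (quantile_le_iff hX hs).2 (hst.trans ((quantile_le_iff hX ht).1 le_rfl))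

lemma aestronglyMeasurable_quantile (hX : AEMeasurable X P) :
    AEStronglyMeasurable (quantile P X) (volume.restrict (Set.Ioo 0 1)) :=
  (aemeasurable_restrict_of_monotoneOn measurableSet_Ioo
    (monotoneOn_quantile hX)).aestronglyMeasurable

/-- Quantiles commute with strictly increasing continuous transformations, here stated for `v` not
necessarily surjective. -/
lemma quantile_comp (hX : AEMeasurable X P) {v : ℝ → ℝ} (hv : StrictMono v) (hc : Continuous v)
    (ht : t ∈ Set.Ioo (0 : ℝ) 1) :
    quantile P (fun ω => v (X ω)) t = v (quantile P X t) := by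
  have hvX : AEMeasurable (fun ω => v (X ω)) P := hc.measurable.comp_aemeasurable hX
  refine eq_of_forall_ge_iff fun m => ?_
  rw [quantile_le_iff hvX ht]
  by_cases hm : m ∈ Set.range v
  · obtain ⟨x, rfl⟩ := hm
    simp only [hv.le_iff_le]
    exact (quantile_le_iff hX ht).symm
  -- outside the interval `range v`, all values of `v` lie on the same side of `m`
  rcases lt_or_ge m (v (quantile P X t)) with h | h
  · have : ∀ x, m < v x := fun x => lt_of_not_ge fun hx =>
      hm (mem_range_of_exists_le_of_exists_ge hc ⟨x, hx⟩ ⟨_, h.le⟩)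
    have h0 : {ω | v (X ω) ≤ m} = ∅ := by
      ext ω; simpa using this (X ω)
    simp [h0, not_le.2 ht.1, h]
  · have : ∀ x, v x ≤ m := fun x => le_of_not_gt fun hx =>
      hm (mem_range_of_exists_le_of_exists_ge hc ⟨_, h⟩ ⟨x, hx.le⟩)
    simp [this, ht.2.le]

lemma abs_quantile_le_of_ae_abs_le (hX : AEMeasurable X P) {B : ℝ} (hB : ∀ᵐ ω ∂P, |X ω| ≤ B)
    (ht : t ∈ Set.Ioo (0 : ℝ) 1) : |quantile P X t| ≤ B := by
  refine abs_le.2 ⟨le_of_forall_lt fun m hm => ?_, ?_⟩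
  · rw [lt_quantile_iff hX ht]
    have : P.real {ω | X ω ≤ m} = 0 := by
      rw [measureReal_eq_zero_iff]
      refine measure_mono_null (fun ω hω => ?_) hB
      have hω' : X ω ≤ m := hω
      exact fun h : |X ω| ≤ B => by linarith [(abs_le.1 h).1]
    rw [this]
    exact ht.1
  · rw [quantile_le_iff hX ht]
    have : P.real {ω | X ω ≤ B} = 1 := by
      rw [← probReal_univ (μ := P)]
      refine measureReal_congr (eventuallyEq_univ.2 ?_)
      filter_upwards [hB] with ω hω using (abs_le.1 hω).2
    rw [this]
    exact ht.2.le

/-- If the limit law puts mass less than `t` on `(-∞, x]` for `x < q` and mass more than `t` for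
`x > q`, then convergence in distribution forces the `t`-quantiles to converge to `q`. -/
lemma tendsto_quantile {ι : Type*} {l : Filter ι} {Y : ι → Ω → ℝ} {Ω' : Type*}
    [MeasurableSpace Ω'] {P' : Measure Ω'} [IsProbabilityMeasure P'] {Z : Ω' → ℝ}
    (h : TendstoInDistribution Y l Z (fun _ => P) P') (ht : t ∈ Set.Ioo (0 : ℝ) 1) {q : ℝ}
    (hlt : ∀ x < q, P'.real {ω | Z ω ≤ x} < t) (hgt : ∀ x > q, t < P'.real {ω | Z ω ≤ x}) :
    Tendsto (fun i => quantile P (Y i) t) l (𝓝 q) := by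
  have hZ := h.aemeasurable_limit
  refine tendsto_order.2 ⟨fun x hx => ?_, fun x hx => ?_⟩
  · have h1 := ProbabilityMeasure.limsup_measure_closed_le_of_tendsto h.tendsto
      (isClosed_Iic (a := x))
    have h2 : (P'.map Z) (Set.Iic x) < ENNReal.ofReal t := by
      rw [Measure.map_apply_of_aemeasurable hZ measurableSet_Iic,
        ENNReal.lt_ofReal_iff_toReal_lt (measure_ne_top _ _)]
      exact hlt x hx
    filter_upwards [eventually_lt_of_limsup_lt (h1.trans_lt h2)] with i hi
    rw [lt_quantile_iff (h.forall_aemeasurable i) ht]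
    simp only [ProbabilityMeasure.coe_mk] at hi
    rw [Measure.map_apply_of_aemeasurable (h.forall_aemeasurable i) measurableSet_Iic,
      ENNReal.lt_ofReal_iff_toReal_lt (measure_ne_top _ _)] at hi
    exact hi
  · obtain ⟨y, hy, hyx⟩ := exists_between hx
    have h1 := ProbabilityMeasure.le_liminf_measure_open_of_tendsto h.tendsto
      (isOpen_Iio (a := y))
    obtain ⟨w, hw, hwy⟩ := exists_between hy
    have h2 : ENNReal.ofReal t < (P'.map Z) (Set.Iio y) := by
      rw [Measure.map_apply_of_aemeasurable hZ measurableSet_Iio]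
      refine lt_of_lt_of_le ?_ (measure_mono (s := {ω | Z ω ≤ w}) fun ω hω => lt_of_le_of_lt hω hwy)
      exact (ENNReal.ofReal_lt_iff_lt_toReal ht.1.le (measure_ne_top _ _)).2 (hgt w hw)
    filter_upwards [eventually_lt_of_lt_liminf (h2.trans_le h1)] with i hi
    refine lt_of_le_of_lt ((quantile_le_iff (h.forall_aemeasurable i) ht).2 ?_) hyx
    simp only [ProbabilityMeasure.coe_mk] at hi
    rw [Measure.map_apply_of_aemeasurable (h.forall_aemeasurable i) measurableSet_Iio,
      ENNReal.ofReal_lt_iff_lt_toReal ht.1.le (measure_ne_top _ _)] at hi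
    exact hi.le.trans (measureReal_mono fun ω (hω : Y i ω < y) => le_of_lt hω)

/-- Bound on the `t`-quantile of a random variable that is sub-Gaussian with parameter `c`. -/
noncomputable def subgaussianEnvelope (c t : ℝ) : ℝ :=
  √(2 * c * -Real.log t) + √(2 * c * -Real.log (1 - t))

/-- A sub-Gaussian random variable has quantiles of size at most `√(log (1 / t))` near `0` and
`√(log (1 / (1 - t)))` near `1`; this inverts the Chernoff bounds for its two tails. -/
lemma abs_quantile_le_subgaussianEnvelope {c : NNReal} (hc : 0 < c) (h : HasSubgaussianMGF X c P)
    (ht : t ∈ Set.Ioo (0 : ℝ) 1) : |quantile P X t| ≤ subgaussianEnvelope c t := by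
  have hX : AEMeasurable X P := h.aemeasurable
  have hc' : (0 : ℝ) < c := hc
  have key : ∀ s ∈ Set.Ioo (0 : ℝ) 1, ∀ m, √(2 * c * -Real.log s) < m →
      Real.exp (-m ^ 2 / (2 * c)) < s := by
    intro s hs m hm
    rw [← Real.lt_log_iff_exp_lt hs.1, div_lt_iff₀ (by positivity)]
    have := (Real.sqrt_lt' (lt_of_le_of_lt (Real.sqrt_nonneg _) hm)).1 hm
    nlinarith
  have hle : √(2 * c * -Real.log (1 - t)) ≤ subgaussianEnvelope c t :=
    le_add_of_nonneg_left (Real.sqrt_nonneg _)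
  have hle' : √(2 * c * -Real.log t) ≤ subgaussianEnvelope c t :=
    le_add_of_nonneg_right (Real.sqrt_nonneg _)
  refine abs_le.2 ⟨le_of_forall_lt fun m hm => ?_, le_of_forall_gt fun m hm => ?_⟩
  · rw [lt_quantile_iff hX ht]
    have hm' : √(2 * c * -Real.log t) < -m := by linarith
    have h0 : 0 ≤ -m := (Real.sqrt_nonneg _).trans hm'.le
    have := h.neg.measure_ge_le h0
    refine lt_of_le_of_lt ?_ (key t ht (-m) hm')
    simpa using this
  · obtain ⟨k, hk, hkm⟩ := exists_between hm
    refine lt_of_le_of_lt ((quantile_le_iff hX ht).2 ?_) hkm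
    have h0 : 0 ≤ k := (Real.sqrt_nonneg _).trans (hle.trans hk.le)
    have h1 := h.measure_ge_le h0
    have h2 := key (1 - t) ⟨by linarith [ht.2], by linarith [ht.1]⟩ k (hle.trans_lt hk)
    have h3 : (1 : ℝ) ≤ P.real {ω | X ω ≤ k} + P.real {ω | k ≤ X ω} := by
      rw [← probReal_univ (μ := P)]
      refine (measureReal_mono (fun ω _ => ?_)).trans (measureReal_union_le _ _)
      exact le_total (X ω) k
    linarith

end Quantile

/-! ### Running means and their mixtures -/

section RunningMean

/-- The mean `(1 / l) ∫_0^l f(t) dt` of `f` over `(0, l)`. -/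
noncomputable def runningMean (f : ℝ → ℝ) (l : ℝ) : ℝ :=
  (1 / l) * ∫ t in (0 : ℝ)..l, f t

/-- Near `0`, the sub-Gaussian envelope is of order `√(log (1 / t))`, hence `o(log (1 / t))`. -/
lemma exists_subgaussianEnvelope_le {c : ℝ} (hc : 0 ≤ c) {δ : ℝ} (hδ : 0 < δ) :
    ∃ t₀ ∈ Set.Ioc (0 : ℝ) 1, ∀ t ∈ Set.Ioo 0 t₀, subgaussianEnvelope c t ≤ δ * -Real.log t := by
  set K := 8 * c / δ ^ 2 + Real.log 2
  have hK : Real.log 2 ≤ K := le_add_of_nonneg_left (by positivity)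
  have hlog2 : 0 < Real.log 2 := Real.log_pos one_lt_two
  refine ⟨Real.exp (-K), ⟨Real.exp_pos _, Real.exp_le_one_iff.2 (by linarith)⟩, fun t ht => ?_⟩
  have hL : K ≤ -Real.log t := by
    have := (Real.log_lt_iff_lt_exp ht.1).2 ht.2
    linarith
  have ht2 : t ≤ 1 / 2 := by
    have h1 : Real.exp (-K) ≤ Real.exp (-Real.log 2) := Real.exp_le_exp.2 (by linarith)
    rw [Real.exp_neg (Real.log 2), Real.exp_log two_pos] at h1
    linarith [ht.2]
  set L := -Real.log t
  have hL0 : 0 ≤ L := by linarith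
  have h1 : √(2 * c * L) ≤ δ / 2 * L := by
    refine Real.sqrt_le_iff.2 ⟨by positivity, ?_⟩
    have h8 : 8 * c / δ ^ 2 ≤ L := by linarith
    rw [div_le_iff₀ (by positivity)] at h8
    nlinarith
  -- for `t ≤ 1 / 2` the contribution of the upper tail is dominated by that of the lower one
  have h2 : √(2 * c * -Real.log (1 - t)) ≤ √(2 * c * L) := by
    refine Real.sqrt_le_sqrt (mul_le_mul_of_nonneg_left (neg_le_neg ?_) (by positivity))
    exact Real.log_le_log ht.1 (by linarith)
  unfold subgaussianEnvelope
  linarith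

lemma intervalIntegrable_subgaussianEnvelope {c : ℝ} (hc : 0 ≤ c) :
    IntervalIntegrable (subgaussianEnvelope c) volume 0 1 := by
  have hlog : IntervalIntegrable (fun t : ℝ => Real.log t) volume 0 1 :=
    intervalIntegral.intervalIntegrable_log'
  have hlog' : IntervalIntegrable (fun t : ℝ => Real.log (1 - t)) volume 0 1 := by
    simpa using (hlog.comp_sub_left 1).symm
  have hsum : IntervalIntegrable
      (fun t : ℝ => (1 + 2 * c * -Real.log t) + (1 + 2 * c * -Real.log (1 - t))) volume 0 1 :=
    (intervalIntegrable_const.add (hlog.neg.const_mul _)).add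
      (intervalIntegrable_const.add (hlog'.neg.const_mul _))
  have hsqrt : ∀ x : ℝ, 0 ≤ x → √x ≤ 1 + x := fun x hx =>
    Real.sqrt_le_iff.2 ⟨by linarith, by nlinarith⟩
  refine hsum.mono_fun (by unfold subgaussianEnvelope; fun_prop) ?_
  rw [Set.uIoc_of_le zero_le_one]
  filter_upwards [ae_restrict_mem measurableSet_Ioc] with t ht
  have h1 : 0 ≤ 2 * c * -Real.log t :=
    mul_nonneg (by positivity) (neg_nonneg.2 (Real.log_nonpos ht.1.le ht.2))
  have h2 : 0 ≤ 2 * c * -Real.log (1 - t) :=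
    mul_nonneg (by positivity) (neg_nonneg.2 (Real.log_nonpos (by linarith [ht.2])
      (by linarith [ht.1])))
  rw [subgaussianEnvelope, Real.norm_of_nonneg (by positivity),
    Real.norm_of_nonneg (by positivity)]
  exact add_le_add (hsqrt _ h1) (hsqrt _ h2)

lemma intervalIntegrable_of_abs_le {f G : ℝ → ℝ}
    (hf : AEStronglyMeasurable f (volume.restrict (Set.Ioo 0 1)))
    (hG : IntervalIntegrable G volume 0 1) (hle : ∀ t ∈ Set.Ioo (0 : ℝ) 1, |f t| ≤ G t) :
    IntervalIntegrable f volume 0 1 := by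
  rw [intervalIntegrable_iff_integrableOn_Ioo_of_le zero_le_one] at hG ⊢
  refine Integrable.mono' hG hf ?_
  filter_upwards [ae_restrict_mem measurableSet_Ioo] with t ht using hle t ht

lemma intervalIntegrable_zero_left {f : ℝ → ℝ} (hf : IntervalIntegrable f volume 0 1) {l : ℝ}
    (hl : l ∈ Set.Ioc (0 : ℝ) 1) : IntervalIntegrable f volume 0 l :=
  hf.mono_set (by
    rw [Set.uIcc_of_le hl.1.le, Set.uIcc_of_le zero_le_one]
    exact Set.Icc_subset_Icc_right hl.2)

/-- The logarithmic bound controls the running mean near `0`, the `L¹` norm controls it elsewhere. -/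
lemma abs_runningMean_le {f : ℝ → ℝ} (hf : IntervalIntegrable f volume 0 1) {δ t₀ : ℝ}
    (hδ : 0 ≤ δ) (ht₀ : 0 < t₀) (hle : ∀ t ∈ Set.Ioo 0 t₀, |f t| ≤ δ * -Real.log t)
    {l : ℝ} (hl : l ∈ Set.Ioc (0 : ℝ) 1) :
    |runningMean f l| ≤ δ * (1 - Real.log l) + t₀⁻¹ * ∫ t in (0 : ℝ)..1, |f t| := by
  have hfl := intervalIntegrable_zero_left hf hl
  have hlog : 0 ≤ -Real.log l := neg_nonneg.2 (Real.log_nonpos hl.1.le hl.2)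
  have hI : 0 ≤ ∫ t in (0 : ℝ)..1, |f t| :=
    intervalIntegral.integral_nonneg zero_le_one fun _ _ => abs_nonneg _
  have h1 : |runningMean f l| ≤ l⁻¹ * ∫ t in (0 : ℝ)..l, |f t| := by
    rw [runningMean, abs_mul, one_div, abs_of_pos (inv_pos.2 hl.1)]
    exact mul_le_mul_of_nonneg_left (intervalIntegral.abs_integral_le_integral_abs hl.1.le)
      (inv_pos.2 hl.1).le
  refine h1.trans ?_
  rcases le_or_gt l t₀ with h | h
  · have hint : IntervalIntegrable (fun t => δ * -Real.log t) volume 0 l :=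
      (intervalIntegral.intervalIntegrable_log').neg.const_mul _
    have h2 : ∫ t in (0 : ℝ)..l, |f t| ≤ ∫ t in (0 : ℝ)..l, δ * -Real.log t := by
      refine intervalIntegral.integral_mono_on_of_le_Ioo hl.1.le hfl.abs hint fun t ht => ?_
      exact hle t ⟨ht.1, ht.2.trans_le h⟩
    have h3 : ∫ t in (0 : ℝ)..l, δ * -Real.log t = l * (δ * (1 - Real.log l)) := by
      rw [intervalIntegral.integral_const_mul, intervalIntegral.integral_neg, integral_log]
      simp
      ring
    calc l⁻¹ * ∫ t in (0 : ℝ)..l, |f t| ≤ l⁻¹ * (l * (δ * (1 - Real.log l))) :=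
          mul_le_mul_of_nonneg_left (h2.trans_eq h3) (inv_pos.2 hl.1).le
      _ = δ * (1 - Real.log l) := inv_mul_cancel_left₀ hl.1.ne' _
      _ ≤ _ := le_add_of_nonneg_right (by positivity)
  · have h2 : ∫ t in (0 : ℝ)..l, |f t| ≤ ∫ t in (0 : ℝ)..1, |f t| :=
      intervalIntegral.integral_mono_interval le_rfl hl.1.le hl.2
        (Eventually.of_forall fun _ => abs_nonneg _) hf.abs
    calc l⁻¹ * ∫ t in (0 : ℝ)..l, |f t| ≤ t₀⁻¹ * ∫ t in (0 : ℝ)..1, |f t| :=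
          mul_le_mul (inv_anti₀ ht₀ h.le) h2
            (intervalIntegral.integral_nonneg hl.1.le fun _ _ => abs_nonneg _) (inv_pos.2 ht₀).le
      _ ≤ _ := le_add_of_nonneg_left (mul_nonneg hδ (by linarith))

lemma continuous_runningMean {f : ℝ → ℝ} (hf : IntervalIntegrable f volume 0 1) :
    Continuous fun l : Set.Ioc (0 : ℝ) 1 => runningMean f l := by
  have h1 : ContinuousOn (fun l => ∫ t in (0 : ℝ)..l, f t) (Set.Icc 0 1) := by
    rw [intervalIntegrable_iff_integrableOn_Icc_of_le zero_le_one,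
      ← Set.uIcc_of_le zero_le_one] at hf
    rw [← Set.uIcc_of_le zero_le_one]
    exact intervalIntegral.continuousOn_primitive_interval hf
  have h2 : ContinuousOn (runningMean f) (Set.Ioc 0 1) :=
    (continuousOn_const.div continuousOn_id fun l hl => hl.1.ne').mul
      (h1.mono Set.Ioc_subset_Icc_self)
  exact continuousOn_iff_continuous_domRestrict.1 h2

variable {μ : Measure (Set.Ioc (0 : ℝ) 1)} [IsProbabilityMeasure μ]

lemma integrable_runningMean (hμ : Integrable (fun l : Set.Ioc (0 : ℝ) 1 => Real.log l) μ)
    {f : ℝ → ℝ} (hf : IntervalIntegrable f volume 0 1) {δ t₀ : ℝ}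
    (hδ : 0 ≤ δ) (ht₀ : 0 < t₀) (hle : ∀ t ∈ Set.Ioo 0 t₀, |f t| ≤ δ * -Real.log t) :
    Integrable (fun l : Set.Ioc (0 : ℝ) 1 => runningMean f l) μ :=
  Integrable.mono' ((((integrable_const 1).sub hμ).const_mul δ).add (integrable_const _))
    (continuous_runningMean hf).aestronglyMeasurable
    (Eventually.of_forall fun l => abs_runningMean_le hf hδ ht₀ hle l.2)

lemma abs_integral_runningMean_le
    (hμ : Integrable (fun l : Set.Ioc (0 : ℝ) 1 => Real.log l) μ) {A : ℝ}
    (hA : -∫ l : Set.Ioc (0 : ℝ) 1, Real.log l ∂μ ≤ A)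
    {f : ℝ → ℝ} (hf : IntervalIntegrable f volume 0 1) {δ t₀ : ℝ}
    (hδ : 0 ≤ δ) (ht₀ : 0 < t₀) (hle : ∀ t ∈ Set.Ioo 0 t₀, |f t| ≤ δ * -Real.log t) :
    |∫ l : Set.Ioc (0 : ℝ) 1, runningMean f l ∂μ| ≤
      δ * (1 + A) + t₀⁻¹ * ∫ t in (0 : ℝ)..1, |f t| := by
  have hint : Integrable (fun l : Set.Ioc (0 : ℝ) 1 =>
      δ * (1 - Real.log l) + t₀⁻¹ * ∫ t in (0 : ℝ)..1, |f t|) μ :=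
    (((integrable_const 1).sub hμ).const_mul δ).add (integrable_const _)
  calc |∫ l : Set.Ioc (0 : ℝ) 1, runningMean f l ∂μ|
      ≤ ∫ l : Set.Ioc (0 : ℝ) 1, |runningMean f l| ∂μ := abs_integral_le_integral_abs
    _ ≤ ∫ l : Set.Ioc (0 : ℝ) 1, (δ * (1 - Real.log l) + t₀⁻¹ * ∫ t in (0 : ℝ)..1, |f t|) ∂μ :=
        integral_mono (integrable_runningMean hμ hf hδ ht₀ hle).abs hint
          fun l => abs_runningMean_le hf hδ ht₀ hle l.2
    _ = δ * (1 - ∫ l : Set.Ioc (0 : ℝ) 1, Real.log l ∂μ) + t₀⁻¹ * ∫ t in (0 : ℝ)..1, |f t| := by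
        have h1 : Integrable (fun l : Set.Ioc (0 : ℝ) 1 => 1 - Real.log l) μ :=
          (integrable_const 1).sub hμ
        rw [integral_add (h1.const_mul δ) (integrable_const _),
          integral_const_mul, integral_sub (integrable_const _) hμ]
        simp
    _ ≤ _ := by
        gcongr
        linarith

/-- Pointwise convergence under an envelope that is integrable and `o(log (1 / t))` at `0` carries
over to mixtures of running means, uniformly over mixing measures with bounded logarithmic moment.
Measures in `M` may charge any neighbourhood of `0`; the `o(log (1 / t))` bound makes up for it. -/
lemma eventually_forall_abs_integral_runningMean_sub_le
    {M : Set (ProbabilityMeasure (Set.Ioc (0 : ℝ) 1))} {A : ℝ}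
    (hM : ∀ μ ∈ M, Integrable (fun l : Set.Ioc (0 : ℝ) 1 => Real.log l) (μ : Measure _))
    (hA : ∀ μ ∈ M, -∫ l : Set.Ioc (0 : ℝ) 1, Real.log l ∂(μ : Measure _) ≤ A)
    {f : ℕ → ℝ → ℝ} {g G : ℝ → ℝ}
    (hf : ∀ n, AEStronglyMeasurable (f n) (volume.restrict (Set.Ioo 0 1)))
    (hg : AEStronglyMeasurable g (volume.restrict (Set.Ioo 0 1)))
    (hG : IntervalIntegrable G volume 0 1)
    (hGlog : ∀ δ > 0, ∃ t₀ ∈ Set.Ioc (0 : ℝ) 1, ∀ t ∈ Set.Ioo 0 t₀, G t ≤ δ * -Real.log t)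
    (hfG : ∀ n, ∀ t ∈ Set.Ioo (0 : ℝ) 1, |f n t| ≤ G t)
    (hgG : ∀ t ∈ Set.Ioo (0 : ℝ) 1, |g t| ≤ G t)
    (hlim : ∀ t ∈ Set.Ioo (0 : ℝ) 1, Tendsto (fun n => f n t) atTop (𝓝 (g t)))
    {η : ℝ} (hη : 0 < η) :
    ∀ᶠ n in atTop, ∀ μ ∈ M, |∫ l : Set.Ioc (0 : ℝ) 1, runningMean (f n) l ∂(μ : Measure _) -
      ∫ l : Set.Ioc (0 : ℝ) 1, runningMean g l ∂(μ : Measure _)| ≤ η := by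
  rcases M.eq_empty_or_nonempty with rfl | ⟨μ₀, hμ₀⟩
  · simp
  have hA0 : 0 ≤ A := (neg_nonneg.2 (integral_nonpos fun l : Set.Ioc (0 : ℝ) 1 =>
    Real.log_nonpos l.2.1.le l.2.2)).trans (hA μ₀ hμ₀)
  set δ := η / (4 * (1 + A))
  have hδ : 0 < δ := by positivity
  obtain ⟨t₀, ht₀, hG₀⟩ := hGlog δ hδ
  have hfi n := intervalIntegrable_of_abs_le (hf n) hG (hfG n)
  have hgi := intervalIntegrable_of_abs_le hg hG hgG
  have hsmall : ∀ n, ∀ t ∈ Set.Ioo 0 t₀, |f n t - g t| ≤ (2 * δ) * -Real.log t := by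
    intro n t ht
    have ht' : t ∈ Set.Ioo (0 : ℝ) 1 := ⟨ht.1, ht.2.trans_le ht₀.2⟩
    have := abs_sub (f n t) (g t)
    linarith [hfG n t ht', hgG t ht', hG₀ t ht]
  have hae : ∀ {p : ℝ → Prop}, (∀ t ∈ Set.Ioo (0 : ℝ) 1, p t) →
      ∀ᵐ t ∂volume, t ∈ Set.uIoc (0 : ℝ) 1 → p t := by
    intro p hp
    rw [Set.uIoc_of_le zero_le_one]
    filter_upwards [compl_mem_ae_iff.2 (measure_singleton (1 : ℝ))] with t ht1 ht
    exact hp t ⟨ht.1, lt_of_le_of_ne ht.2 ht1⟩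
  have hL1 : Tendsto (fun n => ∫ t in (0 : ℝ)..1, |f n t - g t|) atTop (𝓝 0) := by
    have := intervalIntegral.tendsto_integral_filter_of_dominated_convergence
      (F := fun n t => |f n t - g t|) (f := fun _ => (0 : ℝ)) (a := 0) (b := 1) (μ := volume)
      (l := atTop) (fun t => G t + G t)
      (Eventually.of_forall fun n => ((hfi n).sub hgi).abs.def'.aestronglyMeasurable)
      (Eventually.of_forall fun n => hae fun t ht => by
        rw [Real.norm_of_nonneg (abs_nonneg _)]
        exact (abs_sub _ _).trans (add_le_add (hfG n t ht) (hgG t ht)))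
      (hG.add hG)
      (hae fun t ht => by simpa using ((hlim t ht).sub_const (g t)).abs)
    simpa using this
  have hev : ∀ᶠ n in atTop, ∫ t in (0 : ℝ)..1, |f n t - g t| < t₀ * (η / 2) :=
    (tendsto_order.1 hL1).2 _ (by have := ht₀.1; positivity)
  filter_upwards [hev] with n hn μ hμ
  have hdiff : ∫ l : Set.Ioc (0 : ℝ) 1, runningMean (f n) l ∂(μ : Measure _) -
      ∫ l : Set.Ioc (0 : ℝ) 1, runningMean g l ∂(μ : Measure _) =
      ∫ l : Set.Ioc (0 : ℝ) 1, runningMean (fun t => f n t - g t) l ∂(μ : Measure _) := by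
    rw [← integral_sub]
    · refine integral_congr_ae (Eventually.of_forall fun l => ?_)
      simp only [runningMean]
      rw [intervalIntegral.integral_sub (intervalIntegrable_zero_left (hfi n) l.2)
        (intervalIntegrable_zero_left hgi l.2), mul_sub]
    · exact integrable_runningMean (hM μ hμ) (hfi n) hδ.le ht₀.1 fun t ht =>
        (hfG n t ⟨ht.1, ht.2.trans_le ht₀.2⟩).trans (hG₀ t ht)
    · exact integrable_runningMean (hM μ hμ) hgi hδ.le ht₀.1 fun t ht =>
        (hgG t ⟨ht.1, ht.2.trans_le ht₀.2⟩).trans (hG₀ t ht)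
  rw [hdiff]
  refine (abs_integral_runningMean_le (hM μ hμ) (hA μ hμ) ((hfi n).sub hgi) (by positivity)
    ht₀.1 (hsmall n)).trans ?_
  have h1 : 2 * δ * (1 + A) = η / 2 := by
    simp only [δ]; field_simp; norm_num
  have h2 : t₀⁻¹ * ∫ t in (0 : ℝ)..1, |f n t - g t| ≤ η / 2 := by
    rw [inv_mul_le_iff₀ ht₀.1]; exact hn.le
  linarith

end RunningMean

/-! ### The standard normal quantile function -/

section StandardNormal

/-- The quantile function `Φ⁻¹` of the standard normal law, with junk values outside `(0, 1)`. -/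
noncomputable def normalQuantile (t : ℝ) : ℝ :=
  Function.invFun (fun x : ℝ => cdf (gaussianReal 0 1) x) t

lemma gaussianPDFReal_zero_one (x : ℝ) :
    gaussianPDFReal 0 1 x = (√(2 * Real.pi))⁻¹ * Real.exp (-x ^ 2 / 2) := by
  simp [gaussianPDFReal]

lemma hasDerivAt_gaussianPDFReal (x : ℝ) :
    HasDerivAt (gaussianPDFReal 0 1) (-x * gaussianPDFReal 0 1 x) x := by
  have h : HasDerivAt (fun y : ℝ => -y ^ 2 / 2) (-x) x := by
    refine ((hasDerivAt_pow 2 x).neg.div_const 2).congr_deriv ?_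
    push_cast
    ring
  have := h.exp.const_mul (√(2 * Real.pi))⁻¹
  rw [funext gaussianPDFReal_zero_one]
  exact this.congr_deriv (by ring)

lemma hasDerivAt_cdf_gaussianReal (x : ℝ) :
    HasDerivAt (fun x : ℝ => cdf (gaussianReal 0 1) x) (gaussianPDFReal 0 1 x) x := by
  have hint := integrable_gaussianPDFReal 0 1
  have hcont : Continuous (gaussianPDFReal 0 1) :=
    continuous_iff_continuousAt.2 fun x => (hasDerivAt_gaussianPDFReal x).continuousAt
  have heq : (fun x : ℝ => cdf (gaussianReal 0 1) x) = fun x =>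
      (∫ y in Set.Iic 0, gaussianPDFReal 0 1 y) + ∫ y in (0 : ℝ)..x, gaussianPDFReal 0 1 y := by
    ext x
    rw [cdf_eq_real, measureReal_def, gaussianReal_apply_eq_integral 0 one_ne_zero,
      ENNReal.toReal_ofReal (integral_nonneg fun y => gaussianPDFReal_nonneg 0 1 y),
      ← intervalIntegral.integral_Iic_sub_Iic hint.integrableOn hint.integrableOn]
    ring
  rw [heq]
  exact (intervalIntegral.integral_hasDerivAt_right (hcont.intervalIntegrable _ _)
    (hcont.stronglyMeasurableAtFilter _ _) hcont.continuousAt).const_add _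

lemma strictMono_cdf_gaussianReal : StrictMono fun x : ℝ => cdf (gaussianReal 0 1) x :=
  strictMono_of_deriv_pos fun x => by
    rw [(hasDerivAt_cdf_gaussianReal x).deriv]
    exact gaussianPDFReal_pos 0 1 x one_ne_zero

lemma cdf_normalQuantile {t : ℝ} (ht : t ∈ Set.Ioo (0 : ℝ) 1) :
    cdf (gaussianReal 0 1) (normalQuantile t) = t := by
  refine Function.invFun_eq (f := fun x : ℝ => cdf (gaussianReal 0 1) x) ?_
  have hc : Continuous fun x : ℝ => cdf (gaussianReal 0 1) x :=
    continuous_iff_continuousAt.2 fun x => (hasDerivAt_cdf_gaussianReal x).continuousAt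
  obtain ⟨b, hb⟩ := ((tendsto_order.1 (tendsto_cdf_atBot (gaussianReal 0 1))).2 t ht.1).exists
  obtain ⟨a, ha⟩ := ((tendsto_order.1 (tendsto_cdf_atTop (gaussianReal 0 1))).1 t ht.2).exists
  exact mem_range_of_exists_le_of_exists_ge hc ⟨b, hb.le⟩ ⟨a, ha.le⟩

lemma normalQuantile_le_iff {t : ℝ} (ht : t ∈ Set.Ioo (0 : ℝ) 1) {x : ℝ} :
    normalQuantile t ≤ x ↔ t ≤ cdf (gaussianReal 0 1) x := by
  conv_rhs => rw [← cdf_normalQuantile ht]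
  exact (strictMono_cdf_gaussianReal.le_iff_le).symm

lemma normalQuantile_cdf (x : ℝ) : normalQuantile (cdf (gaussianReal 0 1) x) = x :=
  Function.leftInverse_invFun strictMono_cdf_gaussianReal.injective x

lemma cdf_gaussianReal_mem_Ioo (x : ℝ) : cdf (gaussianReal 0 1) x ∈ Set.Ioo (0 : ℝ) 1 :=
  ⟨(cdf_nonneg _ (x - 1)).trans_lt (strictMono_cdf_gaussianReal (by linarith)),
    (strictMono_cdf_gaussianReal (by linarith : x < x + 1)).trans_le (cdf_le_one _ (x + 1))⟩

lemma monotoneOn_normalQuantile : MonotoneOn normalQuantile (Set.Ioo 0 1) :=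
  fun _ hs _ ht hst => (normalQuantile_le_iff hs).2 (hst.trans_eq (cdf_normalQuantile ht).symm)

lemma continuousAt_normalQuantile {t : ℝ} (ht : t ∈ Set.Ioo (0 : ℝ) 1) :
    ContinuousAt normalQuantile t := by
  refine continuousAt_of_monotoneOn_of_image_mem_nhds monotoneOn_normalQuantile
    (Ioo_mem_nhds ht.1 ht.2) ?_
  have : normalQuantile '' Set.Ioo 0 1 = Set.univ :=
    Set.eq_univ_of_forall fun x => ⟨_, cdf_gaussianReal_mem_Ioo x, normalQuantile_cdf x⟩
  rw [this]
  exact univ_mem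

/-- The derivative of `φ(Φ⁻¹(t))` is `-Φ⁻¹(t)`, because `φ'(x) = -x φ(x)` and `Φ' = φ`. -/
lemma hasDerivAt_gaussianPDFReal_normalQuantile {t : ℝ} (ht : t ∈ Set.Ioo (0 : ℝ) 1) :
    HasDerivAt (fun t => gaussianPDFReal 0 1 (normalQuantile t)) (-normalQuantile t) t := by
  have hpos := gaussianPDFReal_pos 0 1 (normalQuantile t) one_ne_zero
  have h1 : HasDerivAt normalQuantile (gaussianPDFReal 0 1 (normalQuantile t))⁻¹ t := by
    refine HasDerivAt.of_local_left_inverse (continuousAt_normalQuantile ht)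
      (hasDerivAt_cdf_gaussianReal _) hpos.ne' ?_
    filter_upwards [Ioo_mem_nhds ht.1 ht.2] with s hs using cdf_normalQuantile hs
  have := (hasDerivAt_gaussianPDFReal (normalQuantile t)).comp t h1
  rwa [mul_assoc, mul_inv_cancel₀ hpos.ne', mul_one] at this

lemma tendsto_gaussianPDFReal_cocompact :
    Tendsto (gaussianPDFReal 0 1) (cocompact ℝ) (𝓝 0) := by
  have h1 : Tendsto (fun x : ℝ => ‖x‖ ^ 2 / 2) (cocompact ℝ) atTop :=
    ((tendsto_pow_atTop two_ne_zero).comp (tendsto_norm_cocompact_atTop)).atTop_div_const two_pos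
  have h2 := (Real.tendsto_exp_neg_atTop_nhds_zero.comp h1).const_mul (√(2 * Real.pi))⁻¹
  rw [mul_zero] at h2
  refine h2.congr fun x => ?_
  simp [gaussianPDFReal_zero_one, neg_div]

lemma tendsto_normalQuantile_zero : Tendsto normalQuantile (𝓝[>] 0) atBot := by
  refine tendsto_atBot.2 fun K => ?_
  filter_upwards [Ioo_mem_nhdsGT (cdf_gaussianReal_mem_Ioo K).1] with t ht
  exact (normalQuantile_le_iff ⟨ht.1, ht.2.trans (cdf_gaussianReal_mem_Ioo K).2⟩).2 ht.2.le

lemma tendsto_normalQuantile_one : Tendsto normalQuantile (𝓝[<] 1) atTop := by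
  refine tendsto_atTop.2 fun K => ?_
  filter_upwards [Ioo_mem_nhdsLT (cdf_gaussianReal_mem_Ioo K).2] with t ht
  have ht' : t ∈ Set.Ioo (0 : ℝ) 1 := ⟨(cdf_gaussianReal_mem_Ioo K).1.trans ht.1, ht.2⟩
  exact le_of_not_ge fun h => absurd ((normalQuantile_le_iff ht').1 h) (not_le.2 ht.1)

lemma densityAtQuantile_nonneg (l : ℝ) : 0 ≤ densityAtQuantile l := by
  unfold densityAtQuantile
  split_ifs
  · exact gaussianPDFReal_nonneg 0 1 _
  · exact le_rfl

lemma densityAtQuantile_pos {l : ℝ} (hl : l < 1) : 0 < densityAtQuantile l := by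
  rw [densityAtQuantile, if_pos hl]
  exact gaussianPDFReal_pos 0 1 _ one_ne_zero

lemma integral_normalQuantile (hint : IntervalIntegrable normalQuantile volume 0 1) {l : ℝ}
    (hl : l ∈ Set.Ioc (0 : ℝ) 1) :
    ∫ t in (0 : ℝ)..l, normalQuantile t = -densityAtQuantile l := by
  have hright : Tendsto (fun t => gaussianPDFReal 0 1 (normalQuantile t)) (𝓝[<] l)
      (𝓝 (densityAtQuantile l)) := by
    rcases hl.2.lt_or_eq with h | rfl
    · rw [densityAtQuantile, if_pos h]
      exact (hasDerivAt_gaussianPDFReal_normalQuantile ⟨hl.1, h⟩).continuousAt.tendsto.mono_left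
        nhdsWithin_le_nhds
    · rw [densityAtQuantile, if_neg (lt_irrefl _)]
      exact (tendsto_gaussianPDFReal_cocompact.mono_left atTop_le_cocompact).comp
        tendsto_normalQuantile_one
  have hleft : Tendsto (fun t => gaussianPDFReal 0 1 (normalQuantile t)) (𝓝[>] 0) (𝓝 0) :=
    (tendsto_gaussianPDFReal_cocompact.mono_left atBot_le_cocompact).comp
      tendsto_normalQuantile_zero
  have := intervalIntegral.integral_eq_sub_of_hasDerivAt_of_tendsto hl.1
    (fun t ht => hasDerivAt_gaussianPDFReal_normalQuantile ⟨ht.1, ht.2.trans_le hl.2⟩)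
    (intervalIntegrable_zero_left hint hl).neg hleft hright
  rw [intervalIntegral.integral_neg] at this
  linarith

lemma runningMean_normalQuantile (hint : IntervalIntegrable normalQuantile volume 0 1) {l : ℝ}
    (hl : l ∈ Set.Ioc (0 : ℝ) 1) :
    runningMean normalQuantile l = -((1 / l) * densityAtQuantile l) := by
  rw [runningMean, integral_normalQuantile hint hl, mul_neg]

variable {Ω : Type*} [MeasurableSpace Ω] {P : Measure Ω} [IsProbabilityMeasure P] {Z : Ω → ℝ}

lemma quantile_eq_normalQuantile (hZ : HasLaw Z (gaussianReal 0 1) P) {t : ℝ}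
    (ht : t ∈ Set.Ioo (0 : ℝ) 1) : quantile P Z t = normalQuantile t :=
  eq_of_forall_ge_iff fun m => by
    rw [quantile_le_iff hZ.aemeasurable ht, measureReal_setOf_le_eq_cdf hZ.aemeasurable,
      hZ.map_eq, normalQuantile_le_iff ht]

lemma tailMean_eq_runningMean_normalQuantile (hZ : HasLaw Z (gaussianReal 0 1) P) {l : ℝ}
    (hl : l ∈ Set.Ioc (0 : ℝ) 1) : tailMean P Z l = runningMean normalQuantile l := by
  rw [tailMean, runningMean]
  congr 1
  rw [intervalIntegral.integral_of_le hl.1.le, intervalIntegral.integral_of_le hl.1.le,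
    integral_Ioc_eq_integral_Ioo, integral_Ioc_eq_integral_Ioo]
  exact setIntegral_congr_fun measurableSet_Ioo fun t ht =>
    quantile_eq_normalQuantile hZ ⟨ht.1, ht.2.trans_le hl.2⟩

lemma hasSubgaussianMGF_id_gaussianReal : HasSubgaussianMGF id 1 (gaussianReal 0 1) where
  integrable_exp_mul t := integrable_exp_mul_gaussianReal t
  mgf_le t := by simp [mgf_id_gaussianReal]

lemma abs_normalQuantile_le {t : ℝ} (ht : t ∈ Set.Ioo (0 : ℝ) 1) :
    |normalQuantile t| ≤ subgaussianEnvelope 1 t := by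
  have hid : HasLaw id (gaussianReal 0 1) (gaussianReal 0 1) := ⟨aemeasurable_id, Measure.map_id⟩
  rw [← quantile_eq_normalQuantile hid ht]
  exact abs_quantile_le_subgaussianEnvelope one_pos hasSubgaussianMGF_id_gaussianReal ht

lemma aestronglyMeasurable_normalQuantile :
    AEStronglyMeasurable normalQuantile (volume.restrict (Set.Ioo 0 1)) :=
  (aemeasurable_restrict_of_monotoneOn measurableSet_Ioo
    monotoneOn_normalQuantile).aestronglyMeasurable

lemma intervalIntegrable_normalQuantile : IntervalIntegrable normalQuantile volume 0 1 :=
  intervalIntegrable_of_abs_le aestronglyMeasurable_normalQuantile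
    (intervalIntegrable_subgaussianEnvelope zero_le_one) fun _ => abs_normalQuantile_le

end StandardNormal

/-! ### Infima, inverse functions and logarithmic moments -/

section Analysis

/-- The delta method, for deterministic sequences. -/
lemma tendsto_mul_sub_of_hasDerivAt {g : ℝ → ℝ} {g' x v : ℝ} (hg : HasDerivAt g g' x)
    {c y : ℕ → ℝ} (hc : Tendsto c atTop atTop)
    (hy : Tendsto (fun n => c n * (y n - x)) atTop (𝓝 v)) :
    Tendsto (fun n => c n * (g (y n) - g x)) atTop (𝓝 (v * g')) := by
  have h0 : Tendsto (fun n => y n - x) atTop (𝓝 0) := by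
    have := (tendsto_inv_atTop_zero.comp hc).mul hy
    rw [zero_mul] at this
    refine this.congr' ?_
    filter_upwards [hc.eventually_ne_atTop 0] with n hn
    simp [inv_mul_cancel_left₀ hn]
  have := (hasFDerivWithinAt_univ.2 hg.hasFDerivAt).lim (c := c) (d := fun n => y n - x) h0
    (Eventually.of_forall fun _ => Set.mem_univ _) hy
  simpa using this

lemma abs_mul_ciInf_sub_sub_ciInf_le {ι : Type*} [Nonempty ι] {x y : ι → ℝ}
    (hy : BddBelow (Set.range y)) {s c η : ℝ} (hs : 0 < s)
    (h : ∀ i, |s * (x i - c) - y i| ≤ η) : |s * ((⨅ i, x i) - c) - ⨅ i, y i| ≤ η := by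
  have hlow : ∀ i, c + ((⨅ i, y i) - η) / s ≤ x i := fun i => by
    have h1 := (abs_le.1 (h i)).1
    have h2 := ciInf_le hy i
    have h3 : ((⨅ i, y i) - η) / s ≤ x i - c := (div_le_iff₀ hs).2 (by linarith)
    linarith
  have hx : BddBelow (Set.range x) := ⟨_, Set.forall_mem_range.2 hlow⟩
  refine abs_le.2 ⟨?_, ?_⟩
  · have h1 : ((⨅ i, y i) - η) / s ≤ (⨅ i, x i) - c := by linarith [le_ciInf hlow]
    have h2 := (div_le_iff₀ hs).1 h1
    linarith
  · have h1 : s * ((⨅ i, x i) - c) - η ≤ ⨅ i, y i := le_ciInf fun i => by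
      have h2 := (abs_le.1 (h i)).2
      have h3 : s * ((⨅ i, x i) - c) ≤ s * (x i - c) :=
        mul_le_mul_of_nonneg_left (sub_le_sub_right (ciInf_le hx i) c) hs.le
      linarith
    linarith

lemma range_mem_nhds_of_strictMono {u : ℝ → ℝ} (hmono : StrictMono u) (hc : Continuous u) (a : ℝ) :
    Set.range u ∈ 𝓝 (u a) := by
  refine mem_of_superset (Icc_mem_nhds (hmono (sub_one_lt a)) (hmono (lt_add_one a))) ?_
  exact (intermediate_value_Icc (by linarith) hc.continuousOn).trans (Set.image_subset_range _ _)

/-- The chain rule for `u⁻¹ ∘ u = id` shows that `u' ≠ 0` and `(u⁻¹)' = 1 / u'`. -/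
lemma hasDerivAt_invFun {u : ℝ → ℝ} (hu : ContDiff ℝ 1 u) (hmono : StrictMono u)
    (hinv : ContDiffOn ℝ 1 (Function.invFun u) (Set.range u)) (a : ℝ) :
    deriv u a ≠ 0 ∧ HasDerivAt (Function.invFun u) (deriv u a)⁻¹ (u a) := by
  have h1 : HasDerivAt u (deriv u a) a := (hu.differentiable one_ne_zero a).hasDerivAt
  have h2 : HasDerivAt (Function.invFun u) (deriv (Function.invFun u) (u a)) (u a) :=
    ((hinv.contDiffAt (range_mem_nhds_of_strictMono hmono hu.continuous a)).differentiableAt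
      one_ne_zero).hasDerivAt
  have h3 := h2.comp a h1
  have hid : Function.invFun u ∘ u = id :=
    funext fun x => Function.leftInverse_invFun hmono.injective x
  rw [hid] at h3
  have h4 := h3.unique (hasDerivAt_id a)
  have h5 : deriv u a ≠ 0 := fun h => by simp [h] at h4
  refine ⟨h5, ?_⟩
  rwa [eq_inv_of_mul_eq_one_left h4] at h2

/-- The uniform bound on the logarithmic moments, in terms of Bochner integrals. -/
lemma exists_integral_log_bound {M : Set (ProbabilityMeasure (Set.Ioc (0 : ℝ) 1))}
    (hlog : (⨆ μ ∈ M, (∫⁻ l, ENNReal.ofReal (Real.log (1 / (l : ℝ)))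
      ∂(μ : Measure (Set.Ioc (0 : ℝ) 1)))) < (⊤ : ENNReal)) :
    ∃ A : ℝ, ∀ μ ∈ M,
      Integrable (fun l : Set.Ioc (0 : ℝ) 1 => Real.log l) (μ : Measure _) ∧
      -∫ l : Set.Ioc (0 : ℝ) 1, Real.log l ∂(μ : Measure _) ≤ A := by
  simp only [one_div, Real.log_inv] at hlog
  set S := ⨆ μ ∈ M, ∫⁻ l, ENNReal.ofReal (-Real.log (l : ℝ)) ∂(μ : Measure (Set.Ioc (0 : ℝ) 1))
  refine ⟨S.toReal, fun μ hμ => ?_⟩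
  have hle : ∫⁻ l, ENNReal.ofReal (-Real.log (l : ℝ)) ∂(μ : Measure (Set.Ioc (0 : ℝ) 1)) ≤ S :=
    le_iSup₂ (f := fun (μ : ProbabilityMeasure (Set.Ioc (0 : ℝ) 1)) (_ : μ ∈ M) =>
      ∫⁻ l, ENNReal.ofReal (-Real.log (l : ℝ)) ∂(μ : Measure (Set.Ioc (0 : ℝ) 1))) μ hμ
  have hnn : 0 ≤ᵐ[(μ : Measure _)] fun l : Set.Ioc (0 : ℝ) 1 => -Real.log (l : ℝ) :=
    Eventually.of_forall fun l => neg_nonneg.2 (Real.log_nonpos l.2.1.le l.2.2)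
  have hmeas : AEStronglyMeasurable (fun l : Set.Ioc (0 : ℝ) 1 => -Real.log (l : ℝ))
      (μ : Measure _) := (by fun_prop : Measurable _).aestronglyMeasurable
  have hint : Integrable (fun l : Set.Ioc (0 : ℝ) 1 => -Real.log (l : ℝ)) (μ : Measure _) :=
    ⟨hmeas, (hasFiniteIntegral_iff_ofReal hnn).2 (hle.trans_lt hlog)⟩
  refine ⟨by simpa using hint.neg, ?_⟩
  rw [← integral_neg, integral_eq_lintegral_of_nonneg_ae hnn hmeas]
  exact ENNReal.toReal_mono hlog.ne hle

end Analysis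

/-! ### Fluctuations of the average risk -/

section AverageRisk

variable {Ω : Type*} [MeasurableSpace Ω] {P : Measure Ω} {X : ℕ → Ω → ℝ}

/-- The fluctuation `√n (S_n / n - E[X_1])` of the average risk around its mean. -/
noncomputable def fluctuation (P : Measure Ω) (X : ℕ → Ω → ℝ) (n : ℕ) (ω : Ω) : ℝ :=
  (√n)⁻¹ * (∑ k ∈ Finset.range n, X k ω - n * P[X 0])

lemma averageRisk_eq {n : ℕ} (hn : n ≠ 0) (ω : Ω) :
    averageRisk X n ω = P[X 0] + (√n)⁻¹ * fluctuation P X n ω := by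
  have h : (√(n : ℝ))⁻¹ * (√(n : ℝ))⁻¹ = (n : ℝ)⁻¹ := by
    rw [← mul_inv, Real.mul_self_sqrt (Nat.cast_nonneg n)]
  have hn' : (n : ℝ) ≠ 0 := Nat.cast_ne_zero.2 hn
  rw [fluctuation, averageRisk, ← mul_assoc, h]
  field_simp
  ring

lemma exists_ae_abs_le (hbdd : MemLp (X 0) ⊤ P) (hident : ∀ i, IdentDistrib (X i) (X 0) P P) :
    ∃ B : ℝ, 1 ≤ B ∧ ∀ᵐ ω ∂P, ∀ i, |X i ω| ≤ B := by
  have h1 : eLpNormEssSup (X 0) P < ⊤ := by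
    rw [← eLpNorm_exponent_top]; exact hbdd.2
  refine ⟨max 1 (eLpNormEssSup (X 0) P).toReal, le_max_left _ _, ae_all_iff.2 fun i => ?_⟩
  have h0 : ∀ᵐ ω ∂P, X 0 ω ∈ {x : ℝ | |x| ≤ max 1 (eLpNormEssSup (X 0) P).toReal} := by
    filter_upwards [ae_le_eLpNormEssSup (f := X 0) (μ := P)] with ω hω
    refine le_max_of_le_right ?_
    have := ENNReal.toReal_mono h1.ne hω
    simpa using this
  have hs : MeasurableSet {x : ℝ | |x| ≤ max 1 (eLpNormEssSup (X 0) P).toReal} :=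
    measurableSet_le measurable_norm measurable_const
  exact (hident i).symm.ae_mem_snd hs h0

lemma aemeasurable_averageRisk (hX : ∀ i, AEMeasurable (X i) P) (n : ℕ) :
    AEMeasurable (averageRisk X n) P :=
  (Finset.aemeasurable_fun_sum _ fun i _ => hX i).div_const _

lemma ae_abs_averageRisk_le {B : ℝ} (hB : 0 ≤ B) (h : ∀ᵐ ω ∂P, ∀ i, |X i ω| ≤ B) (n : ℕ) :
    ∀ᵐ ω ∂P, |averageRisk X n ω| ≤ B := by
  filter_upwards [h] with ω hω
  rw [averageRisk, abs_div, Nat.abs_cast]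
  refine div_le_of_le_mul₀ (Nat.cast_nonneg n) hB ?_
  refine (Finset.abs_sum_le_sum_abs _ _).trans ((Finset.sum_le_sum fun i _ => hω i).trans_eq ?_)
  simp [mul_comm]

variable [IsProbabilityMeasure P]

/-- By Hoeffding's lemma, all fluctuations are sub-Gaussian with the same parameter. -/
lemma hasSubgaussianMGF_fluctuation (hindep : iIndepFun X P)
    (hident : ∀ i, IdentDistrib (X i) (X 0) P P) {B : NNReal}
    (hB : ∀ᵐ ω ∂P, ∀ i, |X i ω| ≤ B) {n : ℕ} (hn : n ≠ 0) :
    HasSubgaussianMGF (fluctuation P X n) (B ^ 2) P := by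
  have hX i := (hident i).aemeasurable_fst
  have h1 : ∀ i, HasSubgaussianMGF (fun ω => X i ω - P[X 0]) (B ^ 2) P := by
    intro i
    have := hasSubgaussianMGF_of_mem_Icc (a := -B) (b := B) (hX i)
      (by filter_upwards [hB] with ω hω using abs_le.1 (hω i))
    rw [(hident i).integral_eq] at this
    convert this using 2
    ext
    push_cast
    rw [Real.norm_of_nonneg (by linarith [B.2])]
    ring
  have h2 : iIndepFun (fun i ω => X i ω - P[X 0]) P :=
    hindep.comp (fun _ x => x - ∫ ω, X 0 ω ∂P) fun _ => by fun_prop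
  have h3 := (HasSubgaussianMGF.sum_of_iIndepFun h2 (s := Finset.range n)
    fun i _ => h1 i).const_mul (√n)⁻¹
  convert h3 using 1
  · ext ω
    simp [fluctuation]
  · ext
    have hn' : (n : ℝ) ≠ 0 := Nat.cast_ne_zero.2 hn
    change (B : ℝ) ^ 2 = (√(n : ℝ))⁻¹ ^ 2 * ((∑ _i ∈ Finset.range n, B ^ 2 : NNReal) : ℝ)
    simp [inv_pow, Real.sq_sqrt (Nat.cast_nonneg (α := ℝ) n), inv_mul_cancel_left₀ hn']

/-- The central limit theorem for quantiles; for variance `0` both sides vanish. -/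
lemma tendsto_quantile_fluctuation (hX : MemLp (X 0) 2 P) (hindep : iIndepFun X P)
    (hident : ∀ i, IdentDistrib (X i) (X 0) P P) {t : ℝ} (ht : t ∈ Set.Ioo (0 : ℝ) 1) :
    Tendsto (fun n => quantile P (fluctuation P X n) t) atTop
      (𝓝 (√(Var[X 0; P]) * normalQuantile t)) := by
  set σ := √(Var[X 0; P])
  have hid : HasLaw id (gaussianReal 0 1) (gaussianReal 0 1) := ⟨aemeasurable_id, Measure.map_id⟩
  have hlaw : HasLaw (fun x : ℝ => σ * x) (gaussianReal 0 Var[X 0; P].toNNReal)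
      (gaussianReal 0 1) := by
    convert gaussianReal_const_mul hid σ using 2
    · rfl
    · rw [mul_zero]
    · refine NNReal.eq ?_
      change _ = σ ^ 2 * 1
      rw [mul_one, Real.sq_sqrt (variance_nonneg _ _), Real.coe_toNNReal _ (variance_nonneg _ _)]
  have hσ : 0 ≤ σ := Real.sqrt_nonneg _
  have hcdf : ∀ x, (gaussianReal 0 1).real {y : ℝ | y ≤ x} = cdf (gaussianReal 0 1) x := fun x => by
    rw [cdf_eq_real]; rfl
  refine tendsto_quantile (tendstoInDistribution_inv_sqrt_mul_sum_sub hlaw hX hindep hident) ht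
    (fun x hx => ?_) fun x hx => ?_
  · rcases hσ.eq_or_lt with h | h
    · simp only [← h, zero_mul] at hx ⊢
      simp [not_le.2 hx, ht.1]
    · have : {y : ℝ | σ * y ≤ x} = {y | y ≤ x / σ} := by
        ext y; simp [le_div_iff₀ h, mul_comm]
      rw [this, hcdf, ← not_le, ← normalQuantile_le_iff ht, not_le, div_lt_iff₀ h]
      rwa [mul_comm] at hx
  · rcases hσ.eq_or_lt with h | h
    · simp only [← h, zero_mul] at hx ⊢
      simp [le_of_lt hx, ht.2]
    · have : {y : ℝ | σ * y ≤ x} = {y | y ≤ x / σ} := by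
        ext y; simp [le_div_iff₀ h, mul_comm]
      rw [this, hcdf]
      have hlt : normalQuantile t < x / σ := by
        rw [lt_div_iff₀ h, mul_comm]; exact hx
      exact (cdf_normalQuantile ht).symm.trans_lt (strictMono_cdf_gaussianReal hlt)

lemma quantile_comp_averageRisk (hX : ∀ i, AEMeasurable (X i) P) {u : ℝ → ℝ} (hmono : StrictMono u)
    (hc : Continuous u) {n : ℕ} (hn : n ≠ 0) {t : ℝ} (ht : t ∈ Set.Ioo (0 : ℝ) 1) :
    quantile P (fun ω => u (averageRisk X n ω)) t =
      u (P[X 0] + (√n)⁻¹ * quantile P (fluctuation P X n) t) := by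
  have hW : AEMeasurable (fluctuation P X n) P :=
    ((Finset.aemeasurable_fun_sum _ fun i _ => hX i).sub_const _).const_mul _
  have hs : 0 < (√(n : ℝ))⁻¹ := by
    have : (0 : ℝ) < n := Nat.cast_pos.2 (Nat.pos_of_ne_zero hn)
    positivity
  set v : ℝ → ℝ := fun x => u (P[X 0] + (√n)⁻¹ * x) with hv
  have hvmono : StrictMono v := fun x y hxy =>
    hmono (by linarith [mul_lt_mul_of_pos_left hxy hs])
  have hvc : Continuous v := hc.comp (continuous_const.add (continuous_const.mul continuous_id))
  have heq : (fun ω => u (averageRisk X n ω)) = fun ω => v (fluctuation P X n ω) :=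
    funext fun ω => congrArg u (averageRisk_eq hn ω)
  rw [heq, quantile_comp hW hvmono hvc ht]

/-- The quantiles of `√n (u(S_n / n) - u(E[X_1]))` converge to those of `u'(E[X_1]) σ Z`, and are
dominated by a sub-Gaussian envelope uniformly in `n`. -/
lemma quantile_comp_averageRisk_asymptotics (hbdd : MemLp (X 0) ⊤ P) (hindep : iIndepFun X P)
    (hident : ∀ i, IdentDistrib (X i) (X 0) P P)
    {u : ℝ → ℝ} (hu : ContDiff ℝ 1 u) (hmono : StrictMono u) :
    (∃ K c : ℝ, 0 ≤ K ∧ 1 ≤ c ∧ ∀ n : ℕ, ∀ t ∈ Set.Ioo (0 : ℝ) 1,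
      |√n * (quantile P (fun ω => u (averageRisk X n ω)) t - u P[X 0])| ≤
        K * subgaussianEnvelope c t) ∧
    ∀ t ∈ Set.Ioo (0 : ℝ) 1, Tendsto
      (fun n : ℕ => √n * (quantile P (fun ω => u (averageRisk X n ω)) t - u P[X 0])) atTop
      (𝓝 (√(Var[X 0; P]) * normalQuantile t * deriv u P[X 0])) := by
  have hX i := (hident i).aemeasurable_fst
  obtain ⟨B, hB1, hB⟩ := exists_ae_abs_le hbdd hident
  have hB0 : 0 ≤ B := zero_le_one.trans hB1
  have hmean : |P[X 0]| ≤ B := by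
    have := norm_integral_le_of_norm_le_const (f := X 0) (μ := P) (C := B)
      (by filter_upwards [hB] with ω hω using hω 0)
    simpa using this
  refine ⟨?_, fun t ht => ?_⟩
  · obtain ⟨K, hK⟩ := hu.contDiffOn.exists_lipschitzOnWith (s := Set.Icc (-B) B) one_ne_zero
      (convex_Icc _ _) isCompact_Icc
    refine ⟨K, B ^ 2, K.2, one_le_pow₀ hB1, fun n t ht => ?_⟩
    have henv : 0 ≤ subgaussianEnvelope (B ^ 2) t :=
      add_nonneg (Real.sqrt_nonneg _) (Real.sqrt_nonneg _)
    rcases eq_or_ne n 0 with rfl | hn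
    · simpa using mul_nonneg K.2 henv
    have hs : 0 < √(n : ℝ) := Real.sqrt_pos.2 (Nat.cast_pos.2 (Nat.pos_of_ne_zero hn))
    have hmem : |P[X 0] + (√n)⁻¹ * quantile P (fluctuation P X n) t| ≤ B := by
      have := quantile_comp_averageRisk hX strictMono_id continuous_id hn ht
      simp only [id_eq] at this
      rw [← this]
      exact abs_quantile_le_of_ae_abs_le (aemeasurable_averageRisk hX n)
        (ae_abs_averageRisk_le hB0 hB n) ht
    have hq : |quantile P (fluctuation P X n) t| ≤ subgaussianEnvelope (B ^ 2) t := by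
      lift B to NNReal using hB0
      have hB2 : 0 < B ^ 2 := pow_pos (zero_lt_one.trans_le (by exact_mod_cast hB1)) 2
      exact_mod_cast abs_quantile_le_subgaussianEnvelope hB2
        (hasSubgaussianMGF_fluctuation hindep hident hB hn) ht
    have hL := hK.dist_le_mul _ (abs_le.1 hmem) _ (abs_le.1 hmean)
    rw [Real.dist_eq, Real.dist_eq, add_sub_cancel_left, abs_mul, abs_of_pos (inv_pos.2 hs)] at hL
    rw [quantile_comp_averageRisk hX hmono hu.continuous hn ht, abs_mul, abs_of_pos hs]
    calc _ ≤ √(n : ℝ) * (K * ((√n)⁻¹ * |quantile P (fluctuation P X n) t|)) :=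
          mul_le_mul_of_nonneg_left hL hs.le
      _ = K * |quantile P (fluctuation P X n) t| := by field_simp
      _ ≤ _ := mul_le_mul_of_nonneg_left hq K.2
  · have hsqrt : Tendsto (fun n : ℕ => √(n : ℝ)) atTop atTop :=
      Real.tendsto_sqrt_atTop.comp tendsto_natCast_atTop_atTop
    have hder : HasDerivAt u (deriv u P[X 0]) P[X 0] :=
      (hu.differentiable one_ne_zero _).hasDerivAt
    have hlim : Tendsto (fun n : ℕ => √(n : ℝ) *
        ((P[X 0] + (√n)⁻¹ * quantile P (fluctuation P X n) t) - P[X 0])) atTop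
        (𝓝 (√(Var[X 0; P]) * normalQuantile t)) := by
      refine (tendsto_quantile_fluctuation (hbdd.mono_exponent le_top) hindep hident ht).congr' ?_
      filter_upwards [hsqrt.eventually_ne_atTop 0] with n hn
      rw [add_sub_cancel_left, mul_inv_cancel_left₀ hn]
    refine (tendsto_mul_sub_of_hasDerivAt hder hsqrt hlim).congr' ?_
    filter_upwards [eventually_ne_atTop 0] with n hn
    rw [quantile_comp_averageRisk hX hmono hu.continuous hn ht]

end AverageRisk

/-! ### Asymptotics of the certainty equivalent -/

section Limit

lemma subgaussianEnvelope_mono {c d : ℝ} (hcd : c ≤ d) {t : ℝ} (ht : t ∈ Set.Ioo (0 : ℝ) 1) :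
    subgaussianEnvelope c t ≤ subgaussianEnvelope d t := by
  have h1 : 0 ≤ -Real.log t := neg_nonneg.2 (Real.log_nonpos ht.1.le ht.2.le)
  have h2 : 0 ≤ -Real.log (1 - t) :=
    neg_nonneg.2 (Real.log_nonpos (by linarith [ht.2]) (by linarith [ht.1]))
  unfold subgaussianEnvelope
  gcongr

/-- Before applying `u⁻¹`: the functional of the utility `u(S_n / n)`, centred at `u(E[X_1])`, is
asymptotically `u'(E[X_1]) σ / √n` times its value at a standard normal variable. The convergence
of the mixtures is uniform in `M`, so it passes to the infimum. -/
lemma tendsto_sqrt_mul_coherent_sub {Ω : Type*} [MeasurableSpace Ω] {P : Measure Ω}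
    [IsProbabilityMeasure P] {X : ℕ → Ω → ℝ} (hbdd : MemLp (X 0) ⊤ P) (hindep : iIndepFun X P)
    (hident : ∀ i, IdentDistrib (X i) (X 0) P P)
    {u : ℝ → ℝ} (hu : ContDiff ℝ 1 u) (hmono : StrictMono u)
    {M : Set (ProbabilityMeasure (Set.Ioc (0 : ℝ) 1))} (hM : M.Nonempty) {A : ℝ}
    (hA : ∀ μ ∈ M, Integrable (fun l : Set.Ioc (0 : ℝ) 1 => Real.log l) (μ : Measure _) ∧
      -∫ l : Set.Ioc (0 : ℝ) 1, Real.log l ∂(μ : Measure _) ≤ A)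
    (hbelow : BddBelow (Set.range fun μ : M =>
      ∫ l : Set.Ioc (0 : ℝ) 1, runningMean normalQuantile l ∂(μ.1 : Measure _))) :
    Tendsto (fun n : ℕ => √n * (coherent P M (fun ω => u (averageRisk X n ω)) - u P[X 0])) atTop
      (𝓝 ((√(Var[X 0; P]) * ⨅ μ : M,
        ∫ l : Set.Ioc (0 : ℝ) 1, runningMean normalQuantile l ∂(μ.1 : Measure _)) *
          deriv u P[X 0])) := by
  have hne : Nonempty M := hM.to_subtype
  obtain ⟨⟨K, c, hK, hc, hbound⟩, hlim⟩ :=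
    quantile_comp_averageRisk_asymptotics hbdd hindep hident hu hmono
  set κ := √(Var[X 0; P]) * deriv u P[X 0] with hκ
  have hκ0 : 0 ≤ κ := mul_nonneg (Real.sqrt_nonneg _) hmono.monotone.deriv_nonneg
  have hX i := (hident i).aemeasurable_fst
  have huX : ∀ n, AEMeasurable (fun ω => u (averageRisk X n ω)) P := fun n =>
    hu.continuous.measurable.comp_aemeasurable (aemeasurable_averageRisk hX n)
  set f : ℕ → ℝ → ℝ := fun n t =>
    √n * (quantile P (fun ω => u (averageRisk X n ω)) t - u P[X 0]) with hf
  have hfmeas : ∀ n, AEStronglyMeasurable (f n) (volume.restrict (Set.Ioo 0 1)) := fun n =>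
    ((aestronglyMeasurable_quantile (huX n)).sub aestronglyMeasurable_const).const_mul _
  set G : ℝ → ℝ := fun t => (K + κ) * subgaussianEnvelope c t with hG
  have henv : ∀ t, 0 ≤ subgaussianEnvelope c t := fun t =>
    add_nonneg (Real.sqrt_nonneg _) (Real.sqrt_nonneg _)
  have hGint : IntervalIntegrable G volume 0 1 :=
    (intervalIntegrable_subgaussianEnvelope (zero_le_one.trans hc)).const_mul _
  have hGlog : ∀ δ > 0, ∃ t₀ ∈ Set.Ioc (0 : ℝ) 1, ∀ t ∈ Set.Ioo 0 t₀,
      G t ≤ δ * -Real.log t := by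
    intro δ hδ
    obtain ⟨t₀, ht₀, h⟩ := exists_subgaussianEnvelope_le (zero_le_one.trans hc)
      (show 0 < δ / (K + κ + 1) by positivity)
    refine ⟨t₀, ht₀, fun t ht => ?_⟩
    calc G t ≤ (K + κ + 1) * subgaussianEnvelope c t :=
          mul_le_mul_of_nonneg_right (by linarith) (henv t)
      _ ≤ (K + κ + 1) * (δ / (K + κ + 1) * -Real.log t) :=
          mul_le_mul_of_nonneg_left (h t ht) (by positivity)
      _ = δ * -Real.log t := by field_simp
  have hfG : ∀ n, ∀ t ∈ Set.Ioo (0 : ℝ) 1, |f n t| ≤ G t := fun n t ht =>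
    (hbound n t ht).trans (mul_le_mul_of_nonneg_right (by linarith) (henv t))
  have hgG : ∀ t ∈ Set.Ioo (0 : ℝ) 1, |κ * normalQuantile t| ≤ G t := fun t ht => by
    rw [abs_mul, abs_of_nonneg hκ0]
    calc κ * |normalQuantile t| ≤ κ * subgaussianEnvelope c t :=
          mul_le_mul_of_nonneg_left
            ((abs_normalQuantile_le ht).trans (subgaussianEnvelope_mono hc ht)) hκ0
      _ ≤ G t := mul_le_mul_of_nonneg_right (by linarith) (henv t)
  have hlim' : ∀ t ∈ Set.Ioo (0 : ℝ) 1,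
      Tendsto (fun n => f n t) atTop (𝓝 (κ * normalQuantile t)) := fun t ht => by
    convert hlim t ht using 2
    rw [hκ]; ring
  have hscale : ∀ (μ : Measure (Set.Ioc (0 : ℝ) 1)),
      ∫ l : Set.Ioc (0 : ℝ) 1, runningMean (fun t => κ * normalQuantile t) l ∂μ =
        κ * ∫ l : Set.Ioc (0 : ℝ) 1, runningMean normalQuantile l ∂μ := fun μ => by
    rw [← integral_const_mul]
    refine integral_congr_ae (Eventually.of_forall fun l => ?_)
    simp only [runningMean, intervalIntegral.integral_const_mul]
    ring
  -- centring and scaling commute with the running mean and with the mixture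
  have hmix : ∀ n : ℕ, 0 < √(n : ℝ) → ∀ μ ∈ M,
      ∫ l : Set.Ioc (0 : ℝ) 1, runningMean (f n) l ∂(μ : Measure _) =
        √n * (mixture P μ (fun ω => u (averageRisk X n ω)) - u P[X 0]) := by
    intro n hn μ hμ
    obtain ⟨t₀, ht₀, hsmall⟩ := hGlog 1 one_pos
    have hfi := intervalIntegrable_of_abs_le (hfmeas n) hGint (hfG n)
    have hint := integrable_runningMean (hA μ hμ).1 hfi zero_le_one ht₀.1 fun t ht =>
      (hfG n t ⟨ht.1, ht.2.trans_le ht₀.2⟩).trans (hsmall t ht)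
    have htail : ∀ l : Set.Ioc (0 : ℝ) 1, tailMean P (fun ω => u (averageRisk X n ω)) l =
        (√n)⁻¹ * runningMean (f n) l + u P[X 0] := by
      intro l
      have hq : quantile P (fun ω => u (averageRisk X n ω)) =
          fun t => (√n)⁻¹ * f n t + u P[X 0] := by
        ext t
        simp only [hf]
        rw [inv_mul_cancel_left₀ hn.ne', sub_add_cancel]
      have hl : (l : ℝ) ≠ 0 := l.2.1.ne'
      rw [tailMean, hq, intervalIntegral.integral_add
        ((intervalIntegrable_zero_left hfi l.2).const_mul _) intervalIntegrable_const,
        intervalIntegral.integral_const_mul, intervalIntegral.integral_const, runningMean]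
      simp only [sub_zero, smul_eq_mul]
      field_simp
    rw [mixture]
    simp only [htail]
    rw [integral_add (hint.const_mul _) (integrable_const _), integral_const_mul]
    simp [mul_inv_cancel_left₀ hn.ne']
  have htarget : (√(Var[X 0; P]) * ⨅ μ : M,
      ∫ l : Set.Ioc (0 : ℝ) 1, runningMean normalQuantile l ∂(μ.1 : Measure _)) *
        deriv u P[X 0] =
      ⨅ μ : M, ∫ l : Set.Ioc (0 : ℝ) 1,
        runningMean (fun t => κ * normalQuantile t) l ∂(μ.1 : Measure _) := by
    simp only [hscale]
    rw [← Real.mul_iInf_of_nonneg hκ0, hκ]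
    ring
  have hbelow' : BddBelow (Set.range fun μ : M => ∫ l : Set.Ioc (0 : ℝ) 1,
      runningMean (fun t => κ * normalQuantile t) l ∂(μ.1 : Measure _)) := by
    obtain ⟨b, hb⟩ := hbelow
    refine ⟨κ * b, Set.forall_mem_range.2 fun μ => ?_⟩
    rw [hscale]
    exact mul_le_mul_of_nonneg_left (hb ⟨μ, rfl⟩) hκ0
  rw [htarget]
  refine Metric.tendsto_atTop'.2 fun ε hε => ?_
  obtain ⟨N, hN⟩ := eventually_atTop.1 (eventually_forall_abs_integral_runningMean_sub_le
    (fun μ hμ => (hA μ hμ).1) (fun μ hμ => (hA μ hμ).2) hfmeas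
    (aestronglyMeasurable_normalQuantile.const_mul κ) hGint hGlog hfG hgG hlim' (half_pos hε))
  refine ⟨N, fun n hn => ?_⟩
  have hs : 0 < √(n : ℝ) := Real.sqrt_pos.2 (Nat.cast_pos.2 (by omega))
  rw [Real.dist_eq]
  refine lt_of_le_of_lt (abs_mul_ciInf_sub_sub_ciInf_le hbelow' hs fun μ => ?_) (half_lt_self hε)
  rw [← hmix n hs μ.1 μ.2]
  exact hN n hn.le μ.1 μ.2

end Limit

end RiskPool

open RiskPool in
theorem theorem2
    {Ω : Type*} [MeasurableSpace Ω] (P : Measure Ω) [IsProbabilityMeasure P]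
    -- i.i.d. bounded risks; `X 0` is the first one
    (X : ℕ → Ω → ℝ) (hbdd : MemLp (X 0) ⊤ P) (hindep : iIndepFun X P)
    (hident : ∀ i, IdentDistrib (X i) (X 0) P P)
    -- `u` and its inverse, defined on the range of `u`, are `C^1` and strictly increasing
    (u : ℝ → ℝ) (hu : ContDiff ℝ 1 u) (hmono : StrictMono u)
    (hinv : ContDiffOn ℝ 1 (Function.invFun u) (Set.range u))
    (M : Set (ProbabilityMeasure (Set.Ioc (0 : ℝ) 1))) (hM : M.Nonempty)
    (hlog : (⨆ μ ∈ M, (∫⁻ l, ENNReal.ofReal (Real.log (1 / (l : ℝ)))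
      ∂(μ : Measure (Set.Ioc (0 : ℝ) 1)))) < (⊤ : ENNReal))
    -- a standard normal random variable, on `Ω` or on any other probability space
    {Ω' : Type*} [MeasurableSpace Ω'] (P' : Measure Ω') [IsProbabilityMeasure P']
    (Z : Ω' → ℝ) (hZ : HasLaw Z (gaussianReal 0 1) P') :
    -- the integrals, the infimum and the supremum in the limit are genuine
    (∀ μ ∈ M, Integrable (fun l : Set.Ioc (0 : ℝ) 1 => RiskPool.tailMean P' Z (l : ℝ))
        (μ : Measure (Set.Ioc (0 : ℝ) 1)) ∧
      Integrable (fun l : Set.Ioc (0 : ℝ) 1 => (1 / (l : ℝ)) * RiskPool.densityAtQuantile l)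
        (μ : Measure (Set.Ioc (0 : ℝ) 1))) ∧
    BddBelow (Set.range fun μ : M => RiskPool.mixture P' μ.1 Z) ∧
    BddAbove (Set.range fun μ : M => ∫ l, (1 / (l : ℝ)) * RiskPool.densityAtQuantile l
      ∂(μ.1 : Measure (Set.Ioc (0 : ℝ) 1))) ∧
    -- the limit and its three expressions
    Tendsto (fun n : ℕ => √(n : ℝ) * RiskPool.riskPremium P u M X n) atTop
      (𝓝 (-√(Var[X 0; P]) * RiskPool.coherent P' M Z)) ∧
    -√(Var[X 0; P]) * RiskPool.coherent P' M Z =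
      -√(Var[X 0; P]) * (⨅ μ : M, ∫ l, RiskPool.tailMean P' Z (l : ℝ)
        ∂(μ.1 : Measure (Set.Ioc (0 : ℝ) 1))) ∧
    -√(Var[X 0; P]) * RiskPool.coherent P' M Z =
      √(Var[X 0; P]) * (⨆ μ : M, ∫ l, (1 / (l : ℝ)) * RiskPool.densityAtQuantile l
        ∂(μ.1 : Measure (Set.Ioc (0 : ℝ) 1))) ∧
    -- unless the risks are constant or `M` consists of the unit mass at `1` only,
    -- the risk premium is of exact order `1 / √n`
    (0 < √(Var[X 0; P]) →
      (∃ μ ∈ M, (μ : Measure (Set.Ioc (0 : ℝ) 1)) ≠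
        Measure.dirac ⟨1, Set.right_mem_Ioc.2 one_pos⟩) →
      (fun n : ℕ => RiskPool.riskPremium P u M X n) =Θ[atTop] fun n : ℕ => 1 / √(n : ℝ)) := by
  have hne : Nonempty M := hM.to_subtype
  obtain ⟨A, hA⟩ := exists_integral_log_bound hlog
  -- mixtures of running means of the normal quantile function, in both of their forms
  have htail : ∀ l : Set.Ioc (0 : ℝ) 1, tailMean P' Z l = runningMean normalQuantile l :=
    fun l => tailMean_eq_runningMean_normalQuantile hZ l.2
  have hdens : ∀ l : Set.Ioc (0 : ℝ) 1,
      (1 / (l : ℝ)) * densityAtQuantile l = -runningMean normalQuantile l := fun l => by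
    rw [runningMean_normalQuantile intervalIntegrable_normalQuantile l.2, neg_neg]
  obtain ⟨t₀, ht₀, hsmall⟩ := exists_subgaussianEnvelope_le zero_le_one (one_pos (α := ℝ))
  have hle : ∀ t ∈ Set.Ioo 0 t₀, |normalQuantile t| ≤ 1 * -Real.log t := fun t ht =>
    (abs_normalQuantile_le ⟨ht.1, ht.2.trans_le ht₀.2⟩).trans (hsmall t ht)
  have hint : ∀ μ ∈ M, Integrable (fun l : Set.Ioc (0 : ℝ) 1 => runningMean normalQuantile l)
      (μ : Measure _) := fun μ hμ =>
    integrable_runningMean (hA μ hμ).1 intervalIntegrable_normalQuantile zero_le_one ht₀.1 hle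
  have hb : ∀ μ : M, |∫ l : Set.Ioc (0 : ℝ) 1, runningMean normalQuantile l ∂(μ.1 : Measure _)| ≤
      1 * (1 + A) + t₀⁻¹ * ∫ t in (0 : ℝ)..1, |normalQuantile t| := fun μ =>
    abs_integral_runningMean_le (hA μ.1 μ.2).1 (hA μ.1 μ.2).2 intervalIntegrable_normalQuantile
      zero_le_one ht₀.1 hle
  have hbelow : BddBelow (Set.range fun μ : M =>
      ∫ l : Set.Ioc (0 : ℝ) 1, runningMean normalQuantile l ∂(μ.1 : Measure _)) :=
    ⟨_, Set.forall_mem_range.2 fun μ => (abs_le.1 (hb μ)).1⟩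
  have habove : BddAbove (Set.range fun μ : M =>
      -∫ l : Set.Ioc (0 : ℝ) 1, runningMean normalQuantile l ∂(μ.1 : Measure _)) :=
    ⟨_, Set.forall_mem_range.2 fun μ => neg_le.1 (abs_le.1 (hb μ)).1⟩
  have hcoh : coherent P' M Z =
      ⨅ μ : M, ∫ l : Set.Ioc (0 : ℝ) 1, runningMean normalQuantile l ∂(μ.1 : Measure _) := by
    simp only [coherent, mixture, htail]
  have hsup : (⨆ μ : M,
      -∫ l : Set.Ioc (0 : ℝ) 1, runningMean normalQuantile l ∂(μ.1 : Measure _)) =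
      -coherent P' M Z := by
    rw [hcoh, ← neg_one_mul (⨅ μ : M, _), Real.mul_iInf_of_nonpos (by norm_num)]
    simp only [neg_one_mul]
  have hsqrt : Tendsto (fun n : ℕ => √(n : ℝ)) atTop atTop :=
    Real.tendsto_sqrt_atTop.comp tendsto_natCast_atTop_atTop
  have hlimit : Tendsto (fun n : ℕ => √(n : ℝ) * riskPremium P u M X n) atTop
      (𝓝 (-√(Var[X 0; P]) * coherent P' M Z)) := by
    obtain ⟨hd, hder⟩ := hasDerivAt_invFun hu hmono hinv P[X 0]
    have h := (tendsto_mul_sub_of_hasDerivAt hder hsqrt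
      (tendsto_sqrt_mul_coherent_sub hbdd hindep hident hu hmono hM hA hbelow)).neg
    rw [mul_inv_cancel_right₀ hd, ← hcoh, ← neg_mul,
      Function.leftInverse_invFun hmono.injective P[X 0]] at h
    refine h.congr fun n => ?_
    rw [riskPremium, certaintyEquivalent]
    ring
  simp only [mixture, htail, hdens, integral_neg]
  refine ⟨fun μ hμ => ⟨hint μ hμ, (hint μ hμ).neg⟩, hbelow, habove, hlimit, by rw [hcoh],
    by rw [hsup]; ring, ?_⟩
  rintro hσ ⟨μ, hμ, hne1⟩
  -- `μ` charges `(0, 1)`, where `φ(Φ⁻¹(l)) / l` is positive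
  have hpos : 0 < -∫ l : Set.Ioc (0 : ℝ) 1, runningMean normalQuantile l ∂(μ : Measure _) := by
    rw [← integral_neg]
    refine (integral_pos_iff_support_of_nonneg (fun l => ?_) (hint μ hμ).neg).2 ?_
    · rw [Pi.neg_apply, ← hdens]
      exact mul_nonneg (one_div_nonneg.2 l.2.1.le) (densityAtQuantile_nonneg l)
    · refine pos_iff_ne_zero.2 fun h0 => hne1 ?_
      have hae : ∀ᵐ l ∂(μ : Measure (Set.Ioc (0 : ℝ) 1)),
          l = ⟨1, Set.right_mem_Ioc.2 one_pos⟩ := by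
        refine measure_mono_null (fun l hl => ?_) h0
        have hl1 : (l : ℝ) < 1 := lt_of_le_of_ne l.2.2 fun h => hl (Subtype.ext h)
        rw [Function.mem_support, Pi.neg_apply, ← hdens]
        exact (mul_pos (one_div_pos.2 l.2.1) (densityAtQuantile_pos hl1)).ne'
      have hae' : id =ᵐ[(μ : Measure (Set.Ioc (0 : ℝ) 1))]
          fun _ => ⟨1, Set.right_mem_Ioc.2 one_pos⟩ := hae
      have := Measure.map_congr (mβ := inferInstance) hae'
      rw [Measure.map_id, Measure.map_const, measure_univ, one_smul] at this
      exact this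
  have hL : -√(Var[X 0; P]) * coherent P' M Z ≠ 0 := by
    have h1 := le_ciSup habove ⟨μ, hμ⟩
    rw [hsup] at h1
    have h2 := mul_pos hσ (hpos.trans_le h1)
    rw [neg_mul, ← mul_neg]
    exact h2.ne'
  refine (isTheta_of_div_tendsto_nhds_ne_zero (hlimit.congr fun n => ?_) hL).symm
  rw [div_div_eq_mul_div, div_one, mul_comm]
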